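/- Let $\alpha>2$, $\beta>0$, and let $J:\mathbb N\to\mathbb R$ satisfy $J(k)=O(k^{-\alpha})$ as $k\to\infty$; no sign is assumed, and in particular $J(k)\sim k^{-\alpha}$ is allowed. For $p\in[1,2]$ put $V(x)=|x|^p$ and consider $\mathbb Z$-valued fields $\phi=(\phi_i)_{i\in\mathbb Z}\in\Omega=\mathbb Z^{\mathbb Z}$ with formal Hamiltonian $$H(\phi)=\sum_{i\neq j\in\mathbb Z}J(|i-j|)\,V(\phi_i-\phi_j).$$ For finite $\Lambda\subset\mathbb Z$ and $\omega\in\Omega$ let $\mu_\Lambda^\omega$ be the probability measure on the countable set $\{\phi\in\Omega:\phi_i=\omega_i\text{ for all }i\notin\Lambda\}$ with weights proportional to $\exp(-\beta H_\Lambda(\phi))$, where $H_\Lambda$ is the sum of the terms of $H$ with $i\in\Lambda$ or $j\in\Lambda$; it is defined when these sums converge absolutely and the total weight is finite. A Gibbs measure is a probability measure $\mu$ on $\Omega$ (with the product $\sigma$-algebra) such that for every finite $\Lambda\subset\mathbb Z$ the measure $\mu_\Lambda^\omega$ is defined for $\mu$-almost every $\omega$ and $\mu=\int\mu_\Lambda^\omega\,d\mu(\omega)$.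 It is shift-invariant if it is invariant under all translations of $\mathbb Z$. Then delocalisation holds in the following sense. 1. If $p\in\{1,2\}$ (the SOS model and the Discrete Gaussian Chain), there is no shift-invariant Gibbs measure $\mu$ with $\langle|\phi_0|\rangle_\mu<C$ for some finite constant $C$. 2. If $p\in(1,2)$, there is no shift-invariant Gibbs measure $\mu$ with $\langle\phi_0^2\rangle_\mu<C$ for some finite constant $C$. -/

import Mathlib

open MeasureTheory Filter
open scoped ENNReal NNReal

noncomputable section

namespace LongRangeSOS

/-- Height configurations `φ : ℤ → ℤ`, with the product σ-algebra. -/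
abbrev Config : Type := ℤ → ℤ

/-- The potential `V(x) = |x|^p`. -/
def V (p : ℝ) (x : ℤ) : ℝ := |(x : ℝ)| ^ p

/-- The contribution `J(|i - j|) V(φ_i - φ_j)` of the ordered pair `(i, j)`, `i ≠ j`, to the energy
in the volume `Λ`; only the pairs that meet `Λ` contribute. -/
def energyTerm (p : ℝ) (J : ℕ → ℝ) (Λ : Finset ℤ) (φ : Config) (ij : ℤ × ℤ) : ℝ :=
  if ij.1 ≠ ij.2 ∧ (ij.1 ∈ Λ ∨ ij.2 ∈ Λ) then
    J (ij.1 - ij.2).natAbs * V p (φ ij.1 - φ ij.2)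
  else 0

/-- The energy in the volume `Λ`: the part of the formal Hamiltonian
`H(φ) = ∑_{i ≠ j} J(|i - j|) V(φ_i - φ_j)` that depends on the heights in `Λ`. -/
def energy (p : ℝ) (J : ℕ → ℝ) (Λ : Finset ℤ) (φ : Config) : ℝ :=
  ∑' ij : ℤ × ℤ, energyTerm p J Λ φ ij

/-- The configuration equal to `η` in `Λ` and to the boundary condition `ω` outside `Λ`. -/
def glue (Λ : Finset ℤ) (η : Λ → ℤ) (ω : Config) : Config :=
  fun i => if h : i ∈ Λ then η ⟨i, h⟩ else ω i

/-- The Boltzmann weight `exp(-β H_Λ(φ))`. -/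
def weight (β p : ℝ) (J : ℕ → ℝ) (Λ : Finset ℤ) (φ : Config) : ℝ≥0∞ :=
  ENNReal.ofReal (Real.exp (-β * energy p J Λ φ))

/-- The partition function in `Λ` with boundary condition `ω`. -/
def partitionFn (β p : ℝ) (J : ℕ → ℝ) (Λ : Finset ℤ) (ω : Config) : ℝ≥0∞ :=
  ∑' η : Λ → ℤ, weight β p J Λ (glue Λ η ω)

open Classical in
/-- The finite-volume measure `μ_Λ^ω`: a probability measure, when the energies converge
(absolutely) and the partition function is finite. Otherwise there is no such measure and the value
is the zero measure (in `ℝ≥0∞` one has `∞⁻¹ = 0`). -/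
def finiteVolume (β p : ℝ) (J : ℕ → ℝ) (Λ : Finset ℤ) (ω : Config) : Measure Config :=
  if ∀ η : Λ → ℤ, Summable (energyTerm p J Λ (glue Λ η ω)) then
    (partitionFn β p J Λ ω)⁻¹ •
      Measure.sum fun η : Λ → ℤ => weight β p J Λ (glue Λ η ω) • Measure.dirac (glue Λ η ω)
  else 0

/-- Gibbs measures: probability measures with `μ = ∫ μ_Λ^ω dμ(ω)` for all finite `Λ`.
Since `μ` has total mass one, the equation with `A = Set.univ` forces `μ_Λ^ω` to be a genuine
probability measure for `μ`-almost every `ω`. -/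
structure IsGibbs (β p : ℝ) (J : ℕ → ℝ) (μ : Measure Config) : Prop where
  isProbabilityMeasure : IsProbabilityMeasure μ
  dlr : ∀ (Λ : Finset ℤ) (A : Set Config), MeasurableSet A →
    μ A = ∫⁻ ω, finiteVolume β p J Λ ω A ∂μ

/-- Invariance under all translations of `ℤ`. -/
def IsShiftInvariant (μ : Measure Config) : Prop :=
  ∀ v : ℤ, μ.map (fun φ i => φ (i + v)) = μ

end LongRangeSOS

end

/-!
Raising all heights by one on `n` consecutive sites changes only the terms of the pairs with exactly
one site in the interval. There are at most `2 |d|` such pairs of difference `d`, and each term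
changes by at most `(1 + p) |J(|d|)| (1 + |φ_i - φ_j|) ^ q` whenever `p ≤ q + 1`. Under a
shift-invariant measure with finite `q`-th moment, the expected total change is therefore bounded
uniformly in `n`, because `∑ k, k |J(k)| < ∞`. Hence, outside an event of small probability, the
displacement distorts a Gibbs measure only by a factor that does not depend on `n`.
On the other hand it changes the difference between the mean height over the `n` sites and that over
`2n` sites by `1 / 2`, while by the mean ergodic theorem this difference tends to `0` in
probability.
-/

section MeanErgodic

open scoped Topology

variable {X : Type*} [MeasurableSpace X] {μ : Measure X} {T : X → X}

section NormedSpace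

variable {E : Type*} [NormedAddCommGroup E] {p : ℝ≥0∞} {f : X → E}

theorem memLp_birkhoffSum (hT : MeasurePreserving T μ μ) (hf : MemLp f p μ) (n : ℕ) :
    MemLp (birkhoffSum T f n) p μ :=
  memLp_finsetSum _ fun k _ => hf.comp_measurePreserving (hT.iterate k)

theorem eLpNorm_birkhoffSum_le (hT : MeasurePreserving T μ μ) (hf : AEStronglyMeasurable f μ)
    (hp : 1 ≤ p) (n : ℕ) : eLpNorm (birkhoffSum T f n) p μ ≤ n * eLpNorm f p μ := by
  have hsum : birkhoffSum T f n = ∑ k ∈ Finset.range n, f ∘ T^[k] := by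
    ext x
    simp [birkhoffSum]
  calc eLpNorm (birkhoffSum T f n) p μ
      ≤ ∑ k ∈ Finset.range n, eLpNorm (f ∘ T^[k]) p μ :=
        hsum ▸ eLpNorm_sum_le (fun k _ => hf.comp_measurePreserving (hT.iterate k)) hp
    _ = n * eLpNorm f p μ := by simp [eLpNorm_comp_measurePreserving hf (hT.iterate _)]

theorem birkhoffSum_compMeasurePreserving_toLp (hT : MeasurePreserving T μ μ)
    (hf : MemLp f p μ) (n : ℕ) :
    birkhoffSum (Lp.compMeasurePreserving T hT) id n (hf.toLp f) =
      (memLp_birkhoffSum hT hf n).toLp _ := by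
  induction n with
  | zero => simp
  | succ n ih =>
    have hsucc : birkhoffSum T f (n + 1) = birkhoffSum T f n + f ∘ T^[n] := by
      ext x
      simp [birkhoffSum_succ]
    rw [birkhoffSum_succ, ih, id, Lp.compMeasurePreserving_iterate,
      Lp.toLp_compMeasurePreserving hf, ← MemLp.toLp_add]
    simp only [hsucc]

variable (𝕜 : Type*) [RCLike 𝕜] [NormedSpace 𝕜 E]

theorem memLp_birkhoffAverage (hT : MeasurePreserving T μ μ) (hf : MemLp f p μ) (n : ℕ) :
    MemLp (birkhoffAverage 𝕜 T f n) p μ :=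
  (memLp_birkhoffSum hT hf n).const_smul _

theorem eLpNorm_birkhoffAverage_le (hT : MeasurePreserving T μ μ)
    (hf : AEStronglyMeasurable f μ) (hp : 1 ≤ p) (n : ℕ) :
    eLpNorm (birkhoffAverage 𝕜 T f n) p μ ≤ eLpNorm f p μ := by
  rcases eq_or_ne n 0 with rfl | hn
  · simp
  calc eLpNorm (birkhoffAverage 𝕜 T f n) p μ
      = ‖(n : 𝕜)⁻¹‖ₑ * eLpNorm (birkhoffSum T f n) p μ := eLpNorm_const_smul ..
    _ = (n : ℝ≥0∞)⁻¹ * eLpNorm (birkhoffSum T f n) p μ := by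
        rw [enorm_inv (by simpa using hn), ← ofReal_norm, RCLike.norm_natCast,
          ENNReal.ofReal_natCast]
    _ ≤ (n : ℝ≥0∞)⁻¹ * (n * eLpNorm f p μ) := by
        gcongr
        exact eLpNorm_birkhoffSum_le hT hf hp n
    _ = eLpNorm f p μ := ENNReal.inv_mul_cancel_left (by simpa using hn) (by simp)

theorem birkhoffAverage_compMeasurePreserving_toLp (hT : MeasurePreserving T μ μ)
    (hf : MemLp f p μ) (n : ℕ) :
    birkhoffAverage 𝕜 (Lp.compMeasurePreserving T hT) id n (hf.toLp f) =
      (memLp_birkhoffAverage 𝕜 hT hf n).toLp _ := by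
  rw [birkhoffAverage, birkhoffSum_compMeasurePreserving_toLp, ← MemLp.toLp_const_smul]
  rfl

end NormedSpace

section InnerProductSpace

variable (𝕜 : Type*) {E : Type*} [RCLike 𝕜] [NormedAddCommGroup E] [InnerProductSpace 𝕜 E]
  [CompleteSpace E] {p : ℝ≥0∞} {f : X → E}

theorem tendsto_eLpNorm_two_birkhoffAverage_sub (hT : MeasurePreserving T μ μ)
    (hf : MemLp f 2 μ) :
    Tendsto (fun mn : ℕ × ℕ =>
      eLpNorm (birkhoffAverage 𝕜 T f mn.1 - birkhoffAverage 𝕜 T f mn.2) 2 μ) atTop (𝓝 0) := by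
  let U : Lp E 2 μ →L[𝕜] Lp E 2 μ := (Lp.compMeasurePreservingₗᵢ 𝕜 T hT).toContinuousLinearMap
  have havg (n : ℕ) : birkhoffAverage 𝕜 U id n (hf.toLp f) =
      (memLp_birkhoffAverage 𝕜 hT hf n).toLp _ :=
    birkhoffAverage_compMeasurePreserving_toLp 𝕜 hT hf n
  have hcauchy : CauchySeq fun n => birkhoffAverage 𝕜 U id n (hf.toLp f) :=
    (U.tendsto_birkhoffAverage_orthogonalProjection
      (LinearIsometry.norm_toContinuousLinearMap_le _) _).cauchySeq
  have hdist := ENNReal.tendsto_ofReal (cauchySeq_iff_tendsto_dist_atTop_0.1 hcauchy)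
  simpa only [← edist_dist, havg, Lp.edist_toLp_toLp, ENNReal.ofReal_zero] using hdist

theorem tendsto_eLpNorm_birkhoffAverage_sub_of_memLp_two [IsFiniteMeasure μ]
    (hT : MeasurePreserving T μ μ) (hp0 : p ≠ 0) (hp2 : p ≤ 2) (hf : MemLp f 2 μ) :
    Tendsto (fun mn : ℕ × ℕ =>
      eLpNorm (birkhoffAverage 𝕜 T f mn.1 - birkhoffAverage 𝕜 T f mn.2) p μ) atTop (𝓝 0) := by
  have hexp : 0 ≤ 1 / p.toReal - 1 / (2 : ℝ≥0∞).toReal :=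
    sub_nonneg.2 <| one_div_le_one_div_of_le
      (ENNReal.toReal_pos hp0 (ne_top_of_le_ne_top (by simp) hp2))
      (ENNReal.toReal_mono (by simp) hp2)
  have hbound := ENNReal.Tendsto.mul_const (tendsto_eLpNorm_two_birkhoffAverage_sub 𝕜 hT hf)
    (.inr (ENNReal.rpow_ne_top_of_nonneg hexp (measure_ne_top μ Set.univ)))
  rw [zero_mul] at hbound
  exact tendsto_of_tendsto_of_tendsto_of_le_of_le tendsto_const_nhds hbound (fun _ => zero_le)
    fun mn => eLpNorm_le_eLpNorm_mul_rpow_measure_univ hp2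
      ((memLp_birkhoffAverage 𝕜 hT hf _).sub (memLp_birkhoffAverage 𝕜 hT hf _)).1

theorem tendsto_eLpNorm_birkhoffAverage_sub [IsFiniteMeasure μ] (hT : MeasurePreserving T μ μ)
    (hp : 1 ≤ p) (hp2 : p ≤ 2) (hf : MemLp f p μ) :
    Tendsto (fun mn : ℕ × ℕ =>
      eLpNorm (birkhoffAverage 𝕜 T f mn.1 - birkhoffAverage 𝕜 T f mn.2) p μ) atTop (𝓝 0) := by
  refine ENNReal.tendsto_nhds_zero.2 fun ε hε => ?_
  have hε3 : 0 < ε / 3 := ENNReal.div_pos hε.ne' (by simp)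
  obtain ⟨g, hfg, hg⟩ :=
    hf.exists_simpleFunc_eLpNorm_sub_lt (ne_top_of_le_ne_top (by simp) hp2) hε3.ne'
  have hd : MemLp (f - ⇑g) p μ := hf.sub hg
  have hmd (n : ℕ) := (memLp_birkhoffAverage 𝕜 hT hd n).1
  have hmg (n : ℕ) := (memLp_birkhoffAverage 𝕜 hT hg n).1
  have hsmall (n : ℕ) : eLpNorm (birkhoffAverage 𝕜 T (f - ⇑g) n) p μ ≤ ε / 3 :=
    (eLpNorm_birkhoffAverage_le 𝕜 hT hd.1 hp n).trans hfg.le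
  have hsplit (n : ℕ) : birkhoffAverage 𝕜 T f n =
      birkhoffAverage 𝕜 T (f - ⇑g) n + birkhoffAverage 𝕜 T g n := by
    rw [← Pi.add_apply (birkhoffAverage 𝕜 T _), ← birkhoffAverage_add, sub_add_cancel]
  filter_upwards [ENNReal.tendsto_nhds_zero.1 (tendsto_eLpNorm_birkhoffAverage_sub_of_memLp_two 𝕜
    hT (one_pos.trans_le hp).ne' hp2 (g.memLp_of_isFiniteMeasure 2 μ)) (ε / 3) hε3] with mn hmn
  rw [hsplit, hsplit, add_sub_add_comm]
  calc eLpNorm (birkhoffAverage 𝕜 T (f - ⇑g) mn.1 - birkhoffAverage 𝕜 T (f - ⇑g) mn.2 +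
        (birkhoffAverage 𝕜 T g mn.1 - birkhoffAverage 𝕜 T g mn.2)) p μ
      ≤ eLpNorm (birkhoffAverage 𝕜 T (f - ⇑g) mn.1) p μ +
          eLpNorm (birkhoffAverage 𝕜 T (f - ⇑g) mn.2) p μ +
          eLpNorm (birkhoffAverage 𝕜 T g mn.1 - birkhoffAverage 𝕜 T g mn.2) p μ := by
        refine (eLpNorm_add_le ((hmd _).sub (hmd _)) ((hmg _).sub (hmg _)) hp).trans ?_
        gcongr
        exact eLpNorm_sub_le (hmd _) (hmd _) hp
    _ ≤ ε / 3 + ε / 3 + ε / 3 := add_le_add_three (hsmall _) (hsmall _) hmn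
    _ = ε := ENNReal.add_thirds ε

end InnerProductSpace

end MeanErgodic

namespace LongRangeSOS

variable {β p q : ℝ} {J : ℕ → ℝ} {Λ : Finset ℤ} {φ ψ : Config} {μ : Measure Config} {K : ℝ≥0}

section EnergyVariation

/-- The total variation of the energy in `Λ` when the displacement `ψ` is added to `φ`: the sum of
the absolute changes of the single terms, which is meaningful (possibly `∞`) even where the
energies themselves diverge. -/
noncomputable def energyVariation (p : ℝ) (J : ℕ → ℝ) (Λ : Finset ℤ) (ψ φ : Config) : ℝ≥0∞ :=
  ∑' ij : ℤ × ℤ, ‖energyTerm p J Λ (φ + ψ) ij - energyTerm p J Λ φ ij‖ₑ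

@[fun_prop]
theorem measurable_energyTerm (p : ℝ) (J : ℕ → ℝ) (Λ : Finset ℤ) (ij : ℤ × ℤ) :
    Measurable fun φ => energyTerm p J Λ φ ij := by
  unfold energyTerm V
  split_ifs <;> fun_prop

@[fun_prop]
theorem measurable_energyVariation (p : ℝ) (J : ℕ → ℝ) (Λ : Finset ℤ) (ψ : Config) :
    Measurable (energyVariation p J Λ ψ) := by
  unfold energyVariation
  fun_prop

theorem enorm_energy_add_sub_le (h : Summable (energyTerm p J Λ φ))
    (h' : Summable (energyTerm p J Λ (φ + ψ))) :
    ‖energy p J Λ (φ + ψ) - energy p J Λ φ‖ₑ ≤ energyVariation p J Λ ψ φ := by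
  rw [energy, energy, ← h'.tsum_sub h]
  exact enorm_tsum_le_tsum_enorm

theorem weight_le_mul_weight_add (h : Summable (energyTerm p J Λ φ))
    (h' : Summable (energyTerm p J Λ (φ + ψ))) (hK : energyVariation p J Λ ψ φ ≤ K) :
    weight β p J Λ φ ≤ ENNReal.ofReal (Real.exp (|β| * K)) * weight β p J Λ (φ + ψ) := by
  have hdiff : |energy p J Λ (φ + ψ) - energy p J Λ φ| ≤ K := by
    have := (enorm_energy_add_sub_le h h').trans hK
    rwa [Real.enorm_eq_ofReal_abs, ENNReal.ofReal_le_coe] at this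
  have hexp : β * (energy p J Λ (φ + ψ) - energy p J Λ φ) ≤ |β| * K :=
    (le_abs_self _).trans (abs_mul β _ ▸ mul_le_mul_of_nonneg_left hdiff (abs_nonneg β))
  rw [weight, weight, ← ENNReal.ofReal_mul (Real.exp_pos _).le, ← Real.exp_add]
  gcongr
  linarith

theorem glue_add (hψ : ∀ i ∉ Λ, ψ i = 0) (η : Λ → ℤ) (ω : Config) :
    glue Λ η ω + ψ = glue Λ (fun i => η i + ψ i) ω := by
  ext i
  by_cases hi : i ∈ Λ <;> simp [glue, hi, hψ]

theorem finiteVolume_le_of_mapsTo {F G : Set Config} (hψ : ∀ i ∉ Λ, ψ i = 0)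
    (hF : MeasurableSet F) (hG : MeasurableSet G) (hFG : Set.MapsTo (· + ψ) F G)
    (hK : ∀ φ ∈ F, energyVariation p J Λ ψ φ ≤ K) (ω : Config) :
    finiteVolume β p J Λ ω F ≤
      ENNReal.ofReal (Real.exp (|β| * K)) * finiteVolume β p J Λ ω G := by
  unfold finiteVolume
  split_ifs with h
  · simp only [Measure.smul_apply, smul_eq_mul, Measure.sum_apply _ hF, Measure.sum_apply _ hG,
      Measure.dirac_apply' _ hF, Measure.dirac_apply' _ hG]
    rw [mul_left_comm]
    refine mul_le_mul_right ?_ _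
    calc ∑' η, weight β p J Λ (glue Λ η ω) * F.indicator 1 (glue Λ η ω)
        ≤ ∑' η, ENNReal.ofReal (Real.exp (|β| * K)) *
            (weight β p J Λ (glue Λ η ω + ψ) * G.indicator 1 (glue Λ η ω + ψ)) := by
          refine ENNReal.tsum_le_tsum fun η => ?_
          by_cases hη : glue Λ η ω ∈ F
          · simpa [hη, hFG hη] using
              weight_le_mul_weight_add (h η) (glue_add hψ η ω ▸ h _) (hK _ hη)
          · simp [hη]
      _ = ENNReal.ofReal (Real.exp (|β| * K)) *
            ∑' η, weight β p J Λ (glue Λ η ω) * G.indicator 1 (glue Λ η ω) := by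
          simp only [ENNReal.tsum_mul_left, glue_add hψ]
          exact congrArg _ ((Equiv.addRight fun i : Λ => ψ i).tsum_eq fun η =>
            weight β p J Λ (glue Λ η ω) * G.indicator 1 (glue Λ η ω))
  · simp

theorem IsGibbs.measure_le_of_mapsTo (hμ : IsGibbs β p J μ) {F G : Set Config}
    (hψ : ∀ i ∉ Λ, ψ i = 0) (hF : MeasurableSet F) (hG : MeasurableSet G)
    (hFG : Set.MapsTo (· + ψ) F G) (hK : ∀ φ ∈ F, energyVariation p J Λ ψ φ ≤ K) :
    μ F ≤ ENNReal.ofReal (Real.exp (|β| * K)) * μ G := by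
  rw [hμ.dlr Λ F hF, hμ.dlr Λ G hG, ← lintegral_const_mul' _ _ ENNReal.ofReal_ne_top]
  exact lintegral_mono (finiteVolume_le_of_mapsTo hψ hF hG hFG hK)

-- A configuration with `|g| < s / 2` is moved by `ψ` to one with `|g| > s / 2`.
theorem IsGibbs.one_le_of_add_eq (hμ : IsGibbs β p J μ) (hψ : ∀ i ∉ Λ, ψ i = 0)
    {g : Config → ℝ} (hg : Measurable g) {s : ℝ} (hgs : ∀ φ, g (φ + ψ) = g φ + s) (K : ℝ≥0) :
    1 ≤ (1 + ENNReal.ofReal (Real.exp (|β| * K))) * μ {φ | s / 2 ≤ |g φ|} +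
      μ {φ | K ≤ energyVariation p J Λ ψ φ} := by
  have := hμ.isProbabilityMeasure
  set A := {φ | s / 2 ≤ |g φ|}
  set B := {φ | (K : ℝ≥0∞) ≤ energyVariation p J Λ ψ φ}
  have hA : MeasurableSet A := measurableSet_le measurable_const (by fun_prop)
  have hB : MeasurableSet B := measurableSet_le measurable_const (by fun_prop)
  have hmaps : Set.MapsTo (· + ψ) (A ∪ B)ᶜ A := by
    intro φ hφ
    have hsmall : |g φ| < s / 2 := not_le.1 fun h => hφ (.inl h)
    rw [Set.mem_ofPred_eq, hgs]
    linarith [le_abs_self (g φ + s), neg_abs_le (g φ)]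
  have hmove : μ (A ∪ B)ᶜ ≤ ENNReal.ofReal (Real.exp (|β| * K)) * μ A :=
    hμ.measure_le_of_mapsTo hψ (hA.union hB).compl hA hmaps
      fun φ hφ => (not_le.1 fun h => hφ (.inr h)).le
  calc 1 = μ (A ∪ B) + μ (A ∪ B)ᶜ := (prob_add_prob_compl (hA.union hB)).symm
    _ ≤ μ A + μ B + ENNReal.ofReal (Real.exp (|β| * K)) * μ A :=
      add_le_add (measure_union_le A B) hmove
    _ = (1 + ENNReal.ofReal (Real.exp (|β| * K))) * μ A + μ B := by ring

end EnergyVariation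

section Potential

theorem rpow_sub_rpow_le {a b : ℝ} (hp : 0 ≤ p) (hq : 0 ≤ q) (hpq : p ≤ q + 1) (hb : 0 ≤ b)
    (hba : b ≤ a) (hab : a ≤ b + 1) : a ^ p - b ^ p ≤ (1 + p) * (1 + b) ^ q := by
  have hone : 1 ≤ (1 + b) ^ q := Real.one_le_rpow (by linarith) hq
  rcases le_total p 1 with hp1 | hp1
  · have hsub : a ^ p ≤ b ^ p + 1 := by
      calc a ^ p ≤ (b + 1) ^ p := Real.rpow_le_rpow (hb.trans hba) hab hp
        _ ≤ b ^ p + 1 := by simpa using Real.rpow_add_le_add_rpow hb zero_le_one hp hp1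
    nlinarith
  rcases (hb.trans hba).eq_or_lt with rfl | ha
  · rw [le_antisymm hba hb, sub_self]
    positivity
  have hbern : 1 + p * (b / a - 1) ≤ (b / a) ^ p := by
    simpa using one_add_mul_self_le_rpow_one_add (s := b / a - 1)
      (by linarith [div_nonneg hb ha.le]) hp1
  calc a ^ p - b ^ p ≤ p * a ^ (p - 1) * (a - b) := by
        rw [Real.div_rpow hb ha.le, le_div_iff₀ (by positivity)] at hbern
        rw [Real.rpow_sub_one ha.ne']
        field_simp at hbern ⊢
        linarith
    _ ≤ (1 + p) * (1 + b) ^ q * 1 := by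
        gcongr
        · linarith
        · calc a ^ (p - 1) ≤ (1 + b) ^ (p - 1) := by gcongr; linarith
            _ ≤ (1 + b) ^ q := by gcongr <;> linarith
        · linarith
    _ = (1 + p) * (1 + b) ^ q := mul_one _

theorem abs_V_sub_V_le (hp : 0 ≤ p) (hq : 0 ≤ q) (hpq : p ≤ q + 1) {x y : ℤ}
    (hxy : |x - y| ≤ 1) : |V p x - V p y| ≤ (1 + p) * (1 + |(y : ℝ)|) ^ q := by
  have hdist : |(|(x : ℝ)| - |(y : ℝ)|)| ≤ 1 :=
    (abs_abs_sub_abs_le_abs_sub _ _).trans (by exact_mod_cast hxy)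
  obtain ⟨hyx, hxy⟩ := abs_sub_le_iff.1 hdist
  have hx := abs_nonneg (x : ℝ)
  have hy := abs_nonneg (y : ℝ)
  unfold V
  rcases le_total |(x : ℝ)| |(y : ℝ)| with hle | hle
  · rw [abs_sub_comm, abs_of_nonneg (sub_nonneg.2 (by gcongr))]
    refine (rpow_sub_rpow_le hp hq hpq hx hle (by linarith)).trans (by gcongr)
  · rw [abs_of_nonneg (sub_nonneg.2 (by gcongr))]
    exact rpow_sub_rpow_le hp hq hpq hy hle (by linarith)

end Potential

section Plateau

/-- The displacement that raises the heights in `Λ` by one. -/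
def plateau (Λ : Finset ℤ) : Config := fun i => if i ∈ Λ then 1 else 0

/-- The absolute value of the coupling of the ordered pair `ij` if exactly one of its two sites lies
in `Λ`; only these pairs feel the displacement `plateau Λ`. -/
noncomputable def crossingCoupling (J : ℕ → ℝ) (Λ : Finset ℤ) (ij : ℤ × ℤ) : ℝ≥0∞ :=
  if ij.1 ∈ Λ ↔ ij.2 ∈ Λ then 0 else ‖J (ij.1 - ij.2).natAbs‖ₑ

theorem enorm_energyTerm_add_plateau_sub_le (hp : 0 ≤ p) (hq : 0 ≤ q) (hpq : p ≤ q + 1)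
    (ij : ℤ × ℤ) :
    ‖energyTerm p J Λ (φ + plateau Λ) ij - energyTerm p J Λ φ ij‖ₑ ≤
      crossingCoupling J Λ ij *
        ENNReal.ofReal ((1 + p) * (1 + |(φ ij.1 : ℝ) - φ ij.2|) ^ q) := by
  obtain ⟨i, j⟩ := ij
  have hV {x : ℤ} (hx : |x - (φ i - φ j)| ≤ 1) :
      ‖J (i - j).natAbs * V p x - J (i - j).natAbs * V p (φ i - φ j)‖ₑ ≤
        ‖J (i - j).natAbs‖ₑ * ENNReal.ofReal ((1 + p) * (1 + |(φ i : ℝ) - φ j|) ^ q) := by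
    rw [← mul_sub, enorm_mul, Real.enorm_eq_ofReal_abs (V p x - _)]
    gcongr
    exact_mod_cast abs_V_sub_V_le hp hq hpq hx
  by_cases hi : i ∈ Λ <;> by_cases hj : j ∈ Λ
  · simp [energyTerm, plateau, hi, hj]
  · have hij : i ≠ j := fun h => hj (h ▸ hi)
    simpa [energyTerm, plateau, crossingCoupling, hi, hj, hij] using
      hV (x := φ i + 1 - φ j) (by ring_nf; simp)
  · have hij : i ≠ j := fun h => hi (h ▸ hj)
    simpa [energyTerm, plateau, crossingCoupling, hi, hj, hij] using
      hV (x := φ i - (φ j + 1)) (by ring_nf; simp)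
  · simp [energyTerm, hi, hj]

-- The pairs `(i, i + d)` that cross a given end point of the interval are `|d|` in number.
theorem tsum_crossingCoupling_Ico_le (J : ℕ → ℝ) (a b : ℤ) :
    ∑' ij, crossingCoupling J (Finset.Ico a b) ij ≤ 2 * ∑' d : ℤ, d.natAbs * ‖J d.natAbs‖ₑ := by
  have hdiag : ∑' ij, crossingCoupling J (Finset.Ico a b) ij =
      ∑' d : ℤ, ∑' i : ℤ, crossingCoupling J (Finset.Ico a b) (i, i + d) := by
    rw [ENNReal.tsum_comm, ENNReal.tsum_prod']
    exact tsum_congr fun i => ((Equiv.addLeft i).tsum_eq _).symm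
  rw [hdiag, ← ENNReal.tsum_mul_left]
  refine ENNReal.tsum_le_tsum fun d => ?_
  let S (c : ℤ) : Finset ℤ := Finset.Ico (c + min 0 (-d)) (c + max 0 (-d))
  have hcard (c : ℤ) : (S c).card = d.natAbs := by
    rw [Int.card_Ico]
    omega
  have hsupp (i : ℤ) (hi : i ∉ S a ∪ S b) : crossingCoupling J (Finset.Ico a b) (i, i + d) = 0 := by
    refine if_pos ?_
    simp only [S, Finset.mem_union, Finset.mem_Ico] at hi ⊢
    omega
  calc ∑' i, crossingCoupling J (Finset.Ico a b) (i, i + d)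
      = ∑ i ∈ S a ∪ S b, crossingCoupling J (Finset.Ico a b) (i, i + d) := tsum_eq_sum hsupp
    _ ≤ ∑ _i ∈ S a ∪ S b, ‖J d.natAbs‖ₑ := by
        refine Finset.sum_le_sum fun i _ => ?_
        unfold crossingCoupling
        split_ifs <;> simp
    _ = (S a ∪ S b).card * ‖J d.natAbs‖ₑ := by simp
    _ ≤ (d.natAbs + d.natAbs : ℕ) * ‖J d.natAbs‖ₑ := by
        gcongr
        simpa only [hcard] using Finset.card_union_le (S a) (S b)
    _ = 2 * (d.natAbs * ‖J d.natAbs‖ₑ) := by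
        push_cast
        ring

end Plateau

section Moments

theorem rpow_one_add_abs_sub_le (hq : 1 ≤ q) (a b : ℝ) :
    (1 + |a - b|) ^ q ≤ 3 ^ (q - 1) * (1 + |a| ^ q + |b| ^ q) := by
  calc (1 + |a - b|) ^ q ≤ (1 + |a| + |b|) ^ q := by
        rw [add_assoc]
        gcongr
        exact abs_sub a b
    _ ≤ 3 ^ (q - 1) * (1 + |a| ^ q + |b| ^ q) := by
        simpa [Fin.sum_univ_three, Fin.forall_fin_succ] using
          Real.rpow_sum_le_const_mul_sum_rpow_of_nonneg Finset.univ (f := ![1, |a|, |b|]) hq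
            (by simp [Fin.forall_fin_succ])

theorem IsShiftInvariant.lintegral_apply (hμ : IsShiftInvariant μ) (f : ℤ → ℝ≥0∞) (i : ℤ) :
    ∫⁻ φ, f (φ i) ∂μ = ∫⁻ φ, f (φ 0) ∂μ := by
  conv_rhs => rw [← hμ i]
  rw [lintegral_map (by fun_prop) (by fun_prop)]
  simp

theorem IsShiftInvariant.lintegral_rpow_one_add_abs_sub_le [IsProbabilityMeasure μ]
    (hμ : IsShiftInvariant μ) (hq : 1 ≤ q) (i j : ℤ) :
    ∫⁻ φ, ENNReal.ofReal ((1 + |(φ i : ℝ) - φ j|) ^ q) ∂μ ≤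
      ENNReal.ofReal (3 ^ (q - 1)) * (1 + 2 * ∫⁻ φ, ENNReal.ofReal (|(φ 0 : ℝ)| ^ q) ∂μ) := by
  have hsite := hμ.lintegral_apply fun x => ENNReal.ofReal (|(x : ℝ)| ^ q)
  have hpoint (φ : Config) : ENNReal.ofReal ((1 + |(φ i : ℝ) - φ j|) ^ q) ≤
      ENNReal.ofReal (3 ^ (q - 1)) *
        (1 + ENNReal.ofReal (|(φ i : ℝ)| ^ q) + ENNReal.ofReal (|(φ j : ℝ)| ^ q)) := by
    refine (ENNReal.ofReal_le_ofReal (rpow_one_add_abs_sub_le hq _ _)).trans_eq ?_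
    rw [ENNReal.ofReal_mul (by positivity), ENNReal.ofReal_add (by positivity) (by positivity),
      ENNReal.ofReal_add (by positivity) (by positivity), ENNReal.ofReal_one]
  refine (lintegral_mono hpoint).trans_eq ?_
  rw [lintegral_const_mul _ (by fun_prop), lintegral_add_left (by fun_prop),
    lintegral_add_left (by fun_prop), hsite i, hsite j, lintegral_one, measure_univ, add_assoc,
    two_mul]

theorem IsShiftInvariant.lintegral_energyVariation_plateau_le [IsProbabilityMeasure μ]
    (hμ : IsShiftInvariant μ) (hp : 0 ≤ p) (hq : 1 ≤ q) (hpq : p ≤ q + 1) (J : ℕ → ℝ)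
    (Λ : Finset ℤ) :
    ∫⁻ φ, energyVariation p J Λ (plateau Λ) φ ∂μ ≤
      (∑' ij, crossingCoupling J Λ ij) * (ENNReal.ofReal (1 + p) * (ENNReal.ofReal (3 ^ (q - 1)) *
        (1 + 2 * ∫⁻ φ, ENNReal.ofReal (|(φ 0 : ℝ)| ^ q) ∂μ))) := by
  simp only [energyVariation]
  rw [lintegral_tsum fun ij => by fun_prop, ← ENNReal.tsum_mul_right]
  refine ENNReal.tsum_le_tsum fun ij => ?_
  calc ∫⁻ φ, ‖energyTerm p J Λ (φ + plateau Λ) ij - energyTerm p J Λ φ ij‖ₑ ∂μ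
      ≤ ∫⁻ φ, crossingCoupling J Λ ij * (ENNReal.ofReal (1 + p) *
          ENNReal.ofReal ((1 + |(φ ij.1 : ℝ) - φ ij.2|) ^ q)) ∂μ := by
        refine lintegral_mono fun φ => ?_
        rw [← ENNReal.ofReal_mul (by positivity)]
        exact enorm_energyTerm_add_plateau_sub_le hp (zero_le_one.trans hq) hpq ij
    _ ≤ _ := by
        rw [lintegral_const_mul _ (by fun_prop), lintegral_const_mul _ (by fun_prop)]
        gcongr
        exact hμ.lintegral_rpow_one_add_abs_sub_le hq _ _

theorem tsum_natAbs_mul_enorm_ne_top (hJ : Summable fun k : ℕ => (k : ℝ) * |J k|) :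
    ∑' d : ℤ, (d.natAbs : ℝ≥0∞) * ‖J d.natAbs‖ₑ ≠ ∞ := by
  have hZ : Summable fun d : ℤ => (d.natAbs : ℝ) * |J d.natAbs| :=
    .of_nat_of_neg (by simpa using hJ) (by simpa using hJ)
  convert hZ.tsum_ofReal_ne_top using 4 with d
  rw [ENNReal.ofReal_mul (by positivity), Real.enorm_eq_ofReal_abs, ENNReal.ofReal_natCast]

theorem IsShiftInvariant.exists_lintegral_energyVariation_plateau_Ico_le [IsProbabilityMeasure μ]
    (hμ : IsShiftInvariant μ) (hp : 0 ≤ p) (hq : 1 ≤ q) (hpq : p ≤ q + 1)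
    (hJ : Summable fun k : ℕ => (k : ℝ) * |J k|)
    (hm : ∫⁻ φ, ENNReal.ofReal (|(φ 0 : ℝ)| ^ q) ∂μ ≠ ∞) :
    ∃ c : ℝ≥0, ∀ a b : ℤ, ∫⁻ φ, energyVariation p J (.Ico a b) (plateau (.Ico a b)) φ ∂μ ≤ c := by
  have hJ' := tsum_natAbs_mul_enorm_ne_top hJ
  refine ⟨ENNReal.toNNReal ((2 * ∑' d : ℤ, d.natAbs * ‖J d.natAbs‖ₑ) * (ENNReal.ofReal (1 + p) *
    (ENNReal.ofReal (3 ^ (q - 1)) * (1 + 2 * ∫⁻ φ, ENNReal.ofReal (|(φ 0 : ℝ)| ^ q) ∂μ)))),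
    fun a b => ?_⟩
  rw [ENNReal.coe_toNNReal (by finiteness)]
  refine (hμ.lintegral_energyVariation_plateau_le hp hq hpq J _).trans ?_
  gcongr
  exact tsum_crossingCoupling_Ico_le J a b

theorem IsShiftInvariant.exists_measure_le_energyVariation_plateau_Ico_le [IsProbabilityMeasure μ]
    (hμ : IsShiftInvariant μ) (hp : 0 ≤ p) (hq : 1 ≤ q) (hpq : p ≤ q + 1)
    (hJ : Summable fun k : ℕ => (k : ℝ) * |J k|)
    (hm : ∫⁻ φ, ENNReal.ofReal (|(φ 0 : ℝ)| ^ q) ∂μ ≠ ∞) {ε : ℝ≥0} (hε : 0 < ε) :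
    ∃ K : ℝ≥0, ∀ a b : ℤ,
      μ {φ | K ≤ energyVariation p J (.Ico a b) (plateau (.Ico a b)) φ} ≤ ε := by
  obtain ⟨c, hc⟩ := hμ.exists_lintegral_energyVariation_plateau_Ico_le hp hq hpq hJ hm
  have hK : ((c + 1) / ε : ℝ≥0) ≠ 0 := by positivity
  refine ⟨(c + 1) / ε, fun a b => (meas_ge_le_lintegral_div (by fun_prop)
    (by exact_mod_cast hK) ENNReal.coe_ne_top).trans (ENNReal.div_le_of_le_mul ?_)⟩
  calc ∫⁻ φ, energyVariation p J (.Ico a b) (plateau (.Ico a b)) φ ∂μ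
      ≤ (c + 1 : ℝ≥0) := (hc a b).trans (by exact_mod_cast le_add_of_nonneg_right zero_le_one)
    _ = ε * ((c + 1) / ε : ℝ≥0) := by
      rw [← ENNReal.coe_mul, mul_div_cancel₀ _ hε.ne']

end Moments

section MeanHeight

/-- The average height over the sites `0, …, n - 1`; it is `0` for `n = 0`. -/
noncomputable def meanHeight (n : ℕ) (φ : Config) : ℝ :=
  (n : ℝ)⁻¹ * ∑ k ∈ Finset.range n, (φ k : ℝ)

@[fun_prop]
theorem measurable_meanHeight (n : ℕ) : Measurable (meanHeight n) := by
  unfold meanHeight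
  fun_prop

theorem meanHeight_add (n : ℕ) (φ ψ : Config) :
    meanHeight n (φ + ψ) = meanHeight n φ + meanHeight n ψ := by
  simp [meanHeight, Finset.sum_add_distrib, mul_add]

theorem meanHeight_plateau_Ico {n m : ℕ} (hnm : n ≤ m) :
    meanHeight m (plateau (.Ico 0 n)) = n / m := by
  have hfilter : {k ∈ Finset.range m | k < n} = Finset.range n := by
    ext k
    simp only [Finset.mem_filter, Finset.mem_range]
    omega
  simp [meanHeight, plateau, hfilter, div_eq_inv_mul]

theorem meanHeight_eq_birkhoffAverage (n : ℕ) :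
    meanHeight n = birkhoffAverage ℝ (fun (φ : Config) i => φ (i + 1)) (fun φ => (φ 0 : ℝ)) n := by
  have hiter (k : ℕ) : (fun (φ : Config) i => φ (i + 1))^[k] = fun φ i => φ (i + k) := by
    induction k with
    | zero => simp [Function.id_def]
    | succ k ih =>
      ext φ i
      rw [Function.iterate_succ_apply, ih]
      push_cast
      ring_nf
  ext φ
  simp [meanHeight, birkhoffAverage, birkhoffSum, hiter]

theorem IsShiftInvariant.tendsto_measure_le_abs_meanHeight_sub [IsFiniteMeasure μ]
    (hμ : IsShiftInvariant μ) (hint : Integrable (fun φ : Config => (φ 0 : ℝ)) μ)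
    {ι : Type*} {l : Filter ι} {m n : ι → ℕ} (hm : Tendsto m l atTop) (hn : Tendsto n l atTop)
    {t : ℝ} (ht : 0 < t) :
    Tendsto (fun i => μ {φ | t ≤ |meanHeight (m i) φ - meanHeight (n i) φ|}) l (nhds 0) := by
  have hT : MeasurePreserving (fun (φ : Config) i => φ (i + 1)) μ μ := ⟨by fun_prop, hμ 1⟩
  have hL1 := tendsto_eLpNorm_birkhoffAverage_sub ℝ hT le_rfl one_le_two
    (memLp_one_iff_integrable.2 hint)
  rw [← prod_atTop_atTop_eq] at hL1
  simp only [← meanHeight_eq_birkhoffAverage] at hL1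
  have hmeas : TendstoInMeasure μ (fun i => meanHeight (m i) - meanHeight (n i)) l 0 :=
    tendstoInMeasure_of_tendsto_eLpNorm one_ne_zero
      (fun i => ((measurable_meanHeight _).sub (measurable_meanHeight _)).aestronglyMeasurable)
      aestronglyMeasurable_zero
      (by simpa only [sub_zero, Function.comp_def] using hL1.comp (hm.prodMk hn))
  simpa using tendstoInMeasure_iff_norm.1 hmeas t ht

theorem integrable_intCast_apply {i : ℤ} (hq : 1 ≤ q)
    (hm : ∫⁻ φ, ENNReal.ofReal (|(φ i : ℝ)| ^ q) ∂μ ≠ ∞) :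
    Integrable (fun φ : Config => (φ i : ℝ)) μ := by
  have hle (x : ℤ) : |(x : ℝ)| ≤ |(x : ℝ)| ^ q := by
    rcases eq_or_ne x 0 with rfl | hx
    · simp [Real.zero_rpow (zero_lt_one.trans_le hq).ne']
    · exact Real.self_le_rpow_of_one_le (by exact_mod_cast Int.one_le_abs hx) hq
  refine ⟨Measurable.aestronglyMeasurable (by fun_prop),
    (lintegral_mono fun φ => ?_).trans_lt hm.lt_top⟩
  rw [Real.enorm_eq_ofReal_abs]
  exact ENNReal.ofReal_le_ofReal (hle _)

-- The plateau on `0, …, n - 1` has mean `1` over these sites and `1 / 2` over the first `2 * n`.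
theorem IsGibbs.one_le_of_meanHeight (hμ : IsGibbs β p J μ) {n : ℕ} (hn : n ≠ 0) (K : ℝ≥0) :
    1 ≤ (1 + ENNReal.ofReal (Real.exp (|β| * K))) *
        μ {φ | 1 / 4 ≤ |meanHeight n φ - meanHeight (2 * n) φ|} +
      μ {φ | K ≤ energyVariation p J (.Ico 0 n) (plateau (.Ico 0 n)) φ} := by
  have hshift (φ : Config) :
      meanHeight n (φ + plateau (.Ico 0 n)) - meanHeight (2 * n) (φ + plateau (.Ico 0 n)) =
        meanHeight n φ - meanHeight (2 * n) φ + 1 / 2 := by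
    rw [meanHeight_add, meanHeight_add, meanHeight_plateau_Ico le_rfl,
      meanHeight_plateau_Ico (show n ≤ 2 * n by omega)]
    push_cast
    field_simp
    ring
  have hquarter : (1 / 4 : ℝ) = 1 / 2 / 2 := by norm_num
  rw [hquarter]
  exact hμ.one_le_of_add_eq (fun i hi => if_neg hi) (by fun_prop) hshift K

end MeanHeight

end LongRangeSOS

theorem summable_natCast_mul_abs_of_isBigO_rpow {α : ℝ} (hα : 2 < α) {J : ℕ → ℝ}
    (hJ : J =O[atTop] fun k : ℕ => (k : ℝ) ^ (-α)) : Summable fun k : ℕ => (k : ℝ) * |J k| := by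
  refine summable_of_isBigO_nat (Real.summable_nat_rpow.2 (by linarith : 1 - α < -1)) ?_
  refine ((Asymptotics.isBigO_refl (fun k : ℕ => (k : ℝ)) atTop).mul hJ.norm_left).congr' .rfl ?_
  filter_upwards [eventually_gt_atTop 0] with k hk
  rw [sub_eq_add_neg, Real.rpow_add (by exact_mod_cast hk), Real.rpow_one]

open LongRangeSOS in
theorem theorem1_general (β p q : ℝ) (hp : 0 ≤ p) (hq : 1 ≤ q) (hpq : p ≤ q + 1) (J : ℕ → ℝ)
    (hJ : Summable fun k : ℕ => (k : ℝ) * |J k|) {μ : Measure Config} (hG : IsGibbs β p J μ)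
    (hμ : IsShiftInvariant μ) : ∫⁻ φ, ENNReal.ofReal (|(φ 0 : ℝ)| ^ q) ∂μ = ∞ := by
  by_contra hm
  have := hG.isProbabilityMeasure
  obtain ⟨K, hK⟩ :=
    hμ.exists_measure_le_energyVariation_plateau_Ico_le hp hq hpq hJ hm one_half_pos
  obtain ⟨M, hMtop, hM⟩ : ∃ M : ℝ≥0∞, M ≠ ∞ ∧ ∀ n : ℕ, n ≠ 0 →
      1 ≤ M * μ {φ | 1 / 4 ≤ |meanHeight n φ - meanHeight (2 * n) φ|} + (1 / 2 : ℝ≥0) :=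
    ⟨_, by finiteness, fun n hn =>
      (hG.one_le_of_meanHeight hn K).trans (add_le_add_right (hK 0 n) _)⟩
  have hmean : Tendsto (fun n => μ {φ | 1 / 4 ≤ |meanHeight n φ - meanHeight (2 * n) φ|}) atTop
      (nhds 0) :=
    hμ.tendsto_measure_le_abs_meanHeight_sub (integrable_intCast_apply hq hm) tendsto_id
      (tendsto_id.const_mul_atTop' two_pos) (by norm_num)
  have hlim := (ENNReal.Tendsto.const_mul hmean (.inr hMtop)).add_const ((1 / 2 : ℝ≥0) : ℝ≥0∞)
  rw [mul_zero, zero_add] at hlim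
  have hhalf : (1 : ℝ≥0∞) ≤ (1 / 2 : ℝ≥0) :=
    ge_of_tendsto hlim ((eventually_ne_atTop 0).mono hM)
  exact hhalf.not_gt (by exact_mod_cast one_half_lt_one)

theorem theorem1 (β α : ℝ) (hβ : 0 < β) (hα : 2 < α) (J : ℕ → ℝ)
    (hJ : J =O[Filter.atTop] fun k : ℕ => (k : ℝ) ^ (-α)) :
    (∀ p : ℝ, p = 1 ∨ p = 2 →
      ¬ ∃ μ : MeasureTheory.Measure LongRangeSOS.Config,
        LongRangeSOS.IsGibbs β p J μ ∧ LongRangeSOS.IsShiftInvariant μ ∧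
          ∃ C : ℝ≥0, ∫⁻ φ, ENNReal.ofReal |(φ 0 : ℝ)| ∂μ < (C : ℝ≥0∞)) ∧
    (∀ p : ℝ, 1 < p → p < 2 →
      ¬ ∃ μ : MeasureTheory.Measure LongRangeSOS.Config,
        LongRangeSOS.IsGibbs β p J μ ∧ LongRangeSOS.IsShiftInvariant μ ∧
          ∃ C : ℝ≥0, ∫⁻ φ, ENNReal.ofReal ((φ 0 : ℝ) ^ 2) ∂μ < (C : ℝ≥0∞)) := by
  have hJ' := summable_natCast_mul_abs_of_isBigO_rpow hα hJ
  constructor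
  · rintro p hp ⟨μ, hG, hμ, C, hC⟩
    obtain ⟨hp0, hp2⟩ : 0 ≤ p ∧ p ≤ 1 + 1 := by rcases hp with rfl | rfl <;> norm_num
    exact hC.ne_top (by simpa using theorem1_general β p 1 hp0 le_rfl hp2 J hJ' hG hμ)
  · rintro p hp1 hp2 ⟨μ, hG, hμ, C, hC⟩
    have htop := theorem1_general β p 2 (by linarith) one_le_two (by linarith) J hJ' hG hμ
    exact hC.ne_top (by simpa using htop)
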